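/- Let $1\le m<p$ be integers and let $f:\{0,\dots,m\}\to\{0,\dots,p\}$ be strictly increasing with $f(0)=0$ and $f(m)=p$. Put $\alpha=\log_{m+1}(p+1)$. For $n\ge 1$ with $(m+1)$-ary expansion $n=\sum_{j=0}^k\epsilon_j(m+1)^j$, let $C_n=\sum_{j=0}^k f(\epsilon_j)(p+1)^j$. Let $\mathfrak C$ be the self-similar set of the iterated function system $S_i(x)=\frac{x+f(i)}{1+p}$, $i=0,\dots,m$, and let $\mu$ be the unique Borel probability measure on $\mathbb R$ (it is supported on $\mathfrak C$) with \[ \mu=\sum_{i=0}^m\frac1{m+1}\,\mu\circ S_i^{-1}. \] For $x>0$ put $d(x)=\mu([0,x])/x^{1/\alpha}$, and let $\Lambda_0$ be the set of all $\ell\in\mathbb R$ for which there is a sequence of positive numbers $x_n\to0$ with $d(x_n)\to\ell$. Then the sequences $\big(n/C_n^{1/\alpha}\big)_{n\ge1}$ and $\big(C_n/n^{\alpha}\big)_{n\ge1}$ are bounded above, $\inf_{n\ge1}C_n/n^\alpha>0$, and \[ \Lambda_0=\left[\inf_{n\ge1}\frac{n}{C_n^{1/\alpha}},\ \sup_{n\ge1}\frac{n}{C_n^{1/\alpha}}\right].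 \] Consequently the lower and upper $1/\alpha$-densities of $\mu$ at $0$ are \[ \liminf_{x\to0^+}d(x)=\left(\sup_{n\ge1}\frac{C_n}{n^\alpha}\right)^{-1/\alpha}\quad\text{and}\quad \limsup_{x\to0^+}d(x)=\left(\inf_{n\ge1}\frac{C_n}{n^\alpha}\right)^{-1/\alpha}. \] -/

import Mathlib

open MeasureTheory Filter Topology Set
open scoped ENNReal

noncomputable section

namespace CantorIntegers

/-- The Cantor-integer `C_n` of the base conversion function `f : {0,…,m} → {0,…,p}`: every digit
`ε` of the `(m+1)`-ary expansion of `n` is replaced by `f ε`, and the result is read in base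
`p + 1`. -/
def cantorInt {m p : ℕ} (f : Fin (m + 1) → Fin (p + 1)) (n : ℕ) : ℕ :=
  Nat.ofDigits (p + 1) ((Nat.digits (m + 1) n).map fun ε => (f (Fin.ofNat (m + 1) ε) : ℕ))

/-- `α = log_{m+1} (p+1)`. -/
def alpha (m p : ℕ) : ℝ := Real.logb ((m : ℝ) + 1) ((p : ℝ) + 1)

/-- The maps `S_i(x) = (x + f(i)) / (1 + p)` of the iterated function system. -/
def ifs {m p : ℕ} (f : Fin (m + 1) → Fin (p + 1)) (i : Fin (m + 1)) (x : ℝ) : ℝ :=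
  (x + (f i : ℕ)) / (1 + (p : ℝ))

/-- The defining property of the self-similar set of the iterated function system. -/
structure IsSelfSimilarSet {m p : ℕ} (f : Fin (m + 1) → Fin (p + 1)) (K : Set ℝ) : Prop where
  nonempty : K.Nonempty
  isCompact : IsCompact K
  eq_iUnion : K = ⋃ i, ifs f i '' K

/-- The defining property of the self-similar measure: a Borel probability measure with
`μ = ∑ i, 1/(m+1) μ ∘ S_i⁻¹`. -/
structure IsSelfSimilarMeasure {m p : ℕ} (f : Fin (m + 1) → Fin (p + 1)) (μ : Measure ℝ) :
    Prop where
  isProb : IsProbabilityMeasure μ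
  eq_sum : μ = ∑ i, ((m : ℝ≥0∞) + 1)⁻¹ • μ.map (ifs f i)

/-- The coding map `ω ↦ ∑ k, f(ω_k) / (p+1)^(k+1)` of the self-similar set. -/
def coding {m p : ℕ} (f : Fin (m + 1) → Fin (p + 1)) (ω : ℕ → Fin (m + 1)) : ℝ :=
  ∑' k, ((f (ω k) : ℕ) : ℝ) / (1 + (p : ℝ)) ^ (k + 1)

/-- The Cantor set: all `∑ k, f(ω_k) / (p+1)^(k+1)`. It is the self-similar set of the
iterated function system, see `isSelfSimilarSet_cantorSet` and `eq_cantorSet`. -/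
def cantorSet {m p : ℕ} (f : Fin (m + 1) → Fin (p + 1)) : Set ℝ := range (coding f)

/-- The self-similar measure on the Cantor set: the law of `∑ k, f(ω_k) / (p+1)^(k+1)` for
independent uniformly distributed `ω_k ∈ {0,…,m}`. It is the unique self-similar measure of the
iterated function system, see `isSelfSimilarMeasure_cantorMeasure` and `eq_cantorMeasure`. -/
def cantorMeasure {m p : ℕ} (f : Fin (m + 1) → Fin (p + 1)) : Measure ℝ :=
  (Measure.infinitePi fun _ : ℕ =>
    (ProbabilityTheory.uniformOn univ : Measure (Fin (m + 1)))).map (coding f)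

/-- `d(x) = μ([0,x]) / x^s`. -/
def density (μ : Measure ℝ) (s x : ℝ) : ℝ := μ.real (Icc 0 x) / x ^ s

/-- The set of the limits of `d(x_n)` along positive sequences `x_n → 0`. -/
def limitPoints (d : ℝ → ℝ) : Set ℝ :=
  {l | ∃ x : ℕ → ℝ, (∀ n, 0 < x n) ∧ Tendsto x atTop (𝓝 0) ∧
    Tendsto (fun n => d (x n)) atTop (𝓝 l)}

/-- The lower `s`-density of `μ` at `0`: the lower limit of `μ([0,x]) / x^s` as `x → 0⁺`
(taken in the extended reals, where it always exists). -/
def lowerDensity (μ : Measure ℝ) (s : ℝ) : EReal :=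
  liminf (fun x => (density μ s x : EReal)) (𝓝[>] 0)

/-- The upper `s`-density of `μ` at `0`: the upper limit of `μ([0,x]) / x^s` as `x → 0⁺`
(taken in the extended reals, where it always exists). -/
def upperDensity (μ : Measure ℝ) (s : ℝ) : EReal :=
  limsup (fun x => (density μ s x : EReal)) (𝓝[>] 0)

section Facts

variable {m p : ℕ} (f : Fin (m + 1) → Fin (p + 1))

theorem continuous_ifs (i : Fin (m + 1)) : Continuous (ifs f i) := by
  unfold ifs; fun_prop

theorem term_bound (ω : ℕ → Fin (m + 1)) (k : ℕ) :
    ‖((f (ω k) : ℕ) : ℝ) / (1 + (p : ℝ)) ^ (k + 1)‖ ≤ p * (1 / (1 + (p : ℝ))) ^ (k + 1) := by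
  have h1 : ((f (ω k) : ℕ) : ℝ) ≤ p := by exact_mod_cast Nat.lt_succ_iff.mp (f (ω k)).2
  rw [Real.norm_of_nonneg (by positivity), one_div, inv_pow, div_eq_mul_inv]
  gcongr

theorem summable_bound (hp : 0 < p) :
    Summable fun k : ℕ => (p : ℝ) * (1 / (1 + (p : ℝ))) ^ (k + 1) := by
  have hp' : (0 : ℝ) < p := by exact_mod_cast hp
  have h : Summable fun k : ℕ => (1 / (1 + (p : ℝ))) ^ k :=
    summable_geometric_of_lt_one (by positivity) ((div_lt_one (by positivity)).2 (by linarith))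
  exact ((summable_nat_add_iff 1).2 h).mul_left _

theorem continuous_coding (hp : 0 < p) : Continuous (coding f) := by
  unfold coding
  refine continuous_tsum (fun k => ?_) (summable_bound hp) (fun k ω => term_bound f ω k)
  have h : Continuous fun a : Fin (m + 1) => ((f a : ℕ) : ℝ) := continuous_of_discreteTopology
  exact (h.comp (continuous_apply k)).div_const _

/-- The word `i ω`. -/
def cons (i : Fin (m + 1)) (ω : ℕ → Fin (m + 1)) : ℕ → Fin (m + 1)
  | 0 => i
  | k + 1 => ω k

theorem measurable_cons (i : Fin (m + 1)) : Measurable (cons i) := by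
  refine measurable_pi_lambda _ fun k => ?_
  cases k with
  | zero => exact measurable_const
  | succ k => exact measurable_pi_apply k

theorem coding_cons (hp : 0 < p) (i : Fin (m + 1)) (ω : ℕ → Fin (m + 1)) :
    coding f (cons i ω) = ifs f i (coding f ω) := by
  have hs : ∀ ω : ℕ → Fin (m + 1),
      Summable fun k => ((f (ω k) : ℕ) : ℝ) / (1 + (p : ℝ)) ^ (k + 1) := fun ω =>
    Summable.of_norm_bounded (summable_bound hp) (term_bound f ω)
  unfold coding ifs
  rw [(hs (cons i ω)).tsum_eq_zero_add, add_div, ← tsum_div_const, add_comm]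
  congr 1
  · refine tsum_congr fun k => ?_
    simp only [cons]
    rw [pow_succ _ (k + 1), div_div]
  · simp [cons]

theorem cons_head_tail (ω : ℕ → Fin (m + 1)) : cons (ω 0) (fun k => ω (k + 1)) = ω := by
  funext k; cases k <;> rfl

/-- The Cantor set is a self-similar set of the iterated function system. -/
theorem isSelfSimilarSet_cantorSet (hp : 0 < p) : IsSelfSimilarSet f (cantorSet f) where
  nonempty := range_nonempty _
  isCompact := isCompact_range (continuous_coding f hp)
  eq_iUnion := by
    ext x
    simp only [cantorSet, mem_iUnion, mem_image, mem_range, exists_exists_eq_and]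
    constructor
    · rintro ⟨ω, rfl⟩
      exact ⟨ω 0, fun k => ω (k + 1), by rw [← coding_cons f hp, cons_head_tail]⟩
    · rintro ⟨i, ω, rfl⟩
      exact ⟨cons i ω, coding_cons f hp i ω⟩

/-- One self-similar set comes arbitrarily close to each point of another one. -/
theorem approx_selfSimilarSet {K L : Set ℝ} (hK : IsSelfSimilarSet f K)
    (hL : IsSelfSimilarSet f L) : ∃ R : ℝ, ∀ n : ℕ, ∀ x ∈ K, ∃ y ∈ L,
      |x - y| ≤ R * (1 / (1 + (p : ℝ))) ^ n := by
  obtain ⟨y₀, hy₀⟩ := hL.nonempty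
  obtain ⟨R, hR⟩ := hK.isCompact.isBounded.subset_closedBall y₀
  refine ⟨R, fun n => ?_⟩
  induction n with
  | zero =>
    intro x hx
    exact ⟨y₀, hy₀, by simpa [Real.dist_eq] using hR hx⟩
  | succ n ih =>
    intro x hx
    rw [hK.eq_iUnion] at hx
    obtain ⟨i, z, hz, rfl⟩ := mem_iUnion.1 hx
    obtain ⟨w, hw, hzw⟩ := ih z hz
    refine ⟨ifs f i w, ?_, ?_⟩
    · rw [hL.eq_iUnion]
      exact mem_iUnion.2 ⟨i, w, hw, rfl⟩
    · have h : ifs f i z - ifs f i w = (z - w) * (1 / (1 + (p : ℝ))) := by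
        unfold ifs; ring
      rw [h, abs_mul, pow_succ, ← mul_assoc, abs_of_nonneg (by positivity : 0 ≤ 1 / (1 + (p : ℝ)))]
      gcongr

theorem selfSimilarSet_subset (hp : 0 < p) {K L : Set ℝ} (hK : IsSelfSimilarSet f K)
    (hL : IsSelfSimilarSet f L) : K ⊆ L := by
  intro x hx
  obtain ⟨R, hR⟩ := approx_selfSimilarSet f hK hL
  choose y hy hxy using fun n => hR n x hx
  have hp' : (0 : ℝ) < p := by exact_mod_cast hp
  have h0 : Tendsto (fun n : ℕ => R * (1 / (1 + (p : ℝ))) ^ n) atTop (𝓝 0) := by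
    simpa using (tendsto_pow_atTop_nhds_zero_of_lt_one (by positivity)
      ((div_lt_one (by positivity)).2 (by linarith : (1 : ℝ) < 1 + p))).const_mul R
  have h1 : Tendsto y atTop (𝓝 x) := by
    rw [tendsto_iff_dist_tendsto_zero]
    refine squeeze_zero (fun _ => dist_nonneg) (fun n => ?_) h0
    rw [dist_comm, Real.dist_eq]
    exact hxy n
  exact hL.isCompact.isClosed.mem_of_tendsto h1 (Eventually.of_forall hy)

/-- The Cantor set is the only self-similar set of the iterated function system. -/
theorem eq_cantorSet (hp : 0 < p) {K : Set ℝ} (hK : IsSelfSimilarSet f K) : K = cantorSet f :=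
  (selfSimilarSet_subset f hp hK (isSelfSimilarSet_cantorSet f hp)).antisymm
    (selfSimilarSet_subset f hp (isSelfSimilarSet_cantorSet f hp) hK)

/-- The uniform Bernoulli measure is invariant under prepending a uniform letter. -/
theorem bernoulli_eq_sum :
    (Measure.infinitePi fun _ : ℕ =>
      (ProbabilityTheory.uniformOn univ : Measure (Fin (m + 1)))) =
    ∑ i, ((m : ℝ≥0∞) + 1)⁻¹ • (Measure.infinitePi fun _ : ℕ =>
      (ProbabilityTheory.uniformOn univ : Measure (Fin (m + 1)))).map (cons i) := by
  classical
  set u : Measure (Fin (m + 1)) := ProbabilityTheory.uniformOn univ with hu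
  symm
  apply Measure.eq_infinitePi
  intro s t _
  obtain ⟨N, hN⟩ : ∃ N, s ⊆ Finset.range (N + 1) :=
    ⟨s.sup id, fun i hi => Finset.mem_range.2 (Nat.lt_succ_of_le (Finset.le_sup (f := id) hi))⟩
  set t' : ℕ → Set (Fin (m + 1)) := fun i => if i ∈ s then t i else univ with ht'
  have hbox : (s : Set ℕ).pi t = (Finset.range (N + 1) : Set ℕ).pi t' := by
    ext x
    simp only [Set.mem_pi, Finset.mem_coe, ht']
    constructor
    · intro h i _
      split_ifs with his
      · exact h i his
      · trivial
    · intro h i his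
      have := h i (hN his)
      rwa [if_pos his] at this
  have hprod : ∏ i ∈ s, u (t i) = ∏ i ∈ Finset.range (N + 1), u (t' i) := by
    rw [← Finset.prod_subset hN]
    · exact Finset.prod_congr rfl fun i hi => by simp [ht', hi]
    · intro i _ hi
      simp [ht', hi]
  have hm : MeasurableSet ((Finset.range (N + 1) : Set ℕ).pi t') :=
    MeasurableSet.pi (Finset.countable_toSet _) fun i _ => (Set.toFinite (t' i)).measurableSet
  have hpre : ∀ i : Fin (m + 1), (Measure.infinitePi fun _ : ℕ => u)
      (cons i ⁻¹' ((Finset.range (N + 1) : Set ℕ).pi t')) =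
      (t' 0).indicator 1 i * ∏ k ∈ Finset.range N, u (t' (k + 1)) := by
    intro i
    by_cases hi : i ∈ t' 0
    · rw [indicator_of_mem hi, Pi.one_apply, one_mul, ← Measure.infinitePi_pi
        (μ := fun _ : ℕ => u) (t := fun k => t' (k + 1))
        fun k _ => (Set.toFinite (t' (k + 1))).measurableSet]
      congr 1
      ext ω
      simp only [mem_preimage, Set.mem_pi, Finset.coe_range, mem_Iio]
      constructor
      · intro h k hk
        exact h (k + 1) (by omega)
      · intro h k hk
        cases k with
        | zero => exact hi
        | succ k => exact h k (by omega)
    · rw [indicator_of_notMem hi, zero_mul]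
      have he : cons i ⁻¹' ((Finset.range (N + 1) : Set ℕ).pi t') = ∅ := by
        rw [eq_empty_iff_forall_notMem]
        intro ω h
        exact hi (h 0 (by simp))
      rw [he, measure_empty]
  have hu0 : u (t' 0) = ∑ i, ((m : ℝ≥0∞) + 1)⁻¹ * (t' 0).indicator 1 i := by
    rw [hu, ProbabilityTheory.uniformOn_univ, Measure.count_apply_finite _ (Set.toFinite _),
      ← Finset.mul_sum, Fintype.card_fin, ENNReal.div_eq_inv_mul]
    have h : ∀ i : Fin (m + 1), (t' 0).indicator (1 : Fin (m + 1) → ℝ≥0∞) i =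
        if i ∈ (Set.toFinite (t' 0)).toFinset then 1 else 0 := fun i => by
      simp [indicator_apply]
    simp_rw [h]
    rw [Finset.sum_ite_mem, Finset.univ_inter, Finset.sum_const, nsmul_one]
    push_cast
    rfl
  rw [hbox, hprod, Measure.finsetSum_apply, Finset.prod_range_succ', hu0, mul_comm,
    Finset.sum_mul]
  refine Finset.sum_congr rfl fun i _ => ?_
  rw [Measure.smul_apply, Measure.map_apply (measurable_cons i) hm, hpre, smul_eq_mul, mul_assoc]

/-- `cantorMeasure f` is a self-similar measure of the iterated function system. -/
theorem isSelfSimilarMeasure_cantorMeasure (hp : 0 < p) :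
    IsSelfSimilarMeasure f (cantorMeasure f) where
  isProb := Measure.isProbabilityMeasure_map (continuous_coding f hp).measurable.aemeasurable
  eq_sum := by
    have hc := (continuous_coding f hp).measurable
    have h : ∀ i, (cantorMeasure f).map (ifs f i) = ((Measure.infinitePi fun _ : ℕ =>
        (ProbabilityTheory.uniformOn univ : Measure (Fin (m + 1)))).map (cons i)).map
        (coding f) := by
      intro i
      rw [cantorMeasure, Measure.map_map (continuous_ifs f i).measurable hc,
        Measure.map_map hc (measurable_cons i)]
      congr 1
      funext ω
      exact (coding_cons f hp i ω).symm
    simp_rw [h]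
    conv_lhs => rw [cantorMeasure, bernoulli_eq_sum]
    rw [← Measure.mapₗ_apply_of_measurable hc, map_sum]
    simp_rw [map_smul, Measure.mapₗ_apply_of_measurable hc]

/-- `cantorMeasure f` is carried by the Cantor set. -/
theorem cantorMeasure_compl (hp : 0 < p) : cantorMeasure f (cantorSet f)ᶜ = 0 := by
  have hc := (continuous_coding f hp).measurable
  rw [cantorMeasure, Measure.map_apply hc
    (isSelfSimilarSet_cantorSet f hp).isCompact.isClosed.measurableSet.compl]
  simp [cantorSet]

/-- The functional equation of the characteristic function of a self-similar measure. -/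
theorem charFun_selfSimilar {μ : Measure ℝ} (hμ : IsSelfSimilarMeasure f μ) (t : ℝ) :
    charFun μ t = (∑ i, ((m : ℂ) + 1)⁻¹ *
      Complex.exp (t * (((f i : ℕ) / (1 + (p : ℝ)) : ℝ) : ℂ) * Complex.I)) *
        charFun μ (t / (1 + (p : ℝ))) := by
  have hprob := hμ.isProb
  have hbdd : ∀ (ν : Measure ℝ) [IsFiniteMeasure ν],
      Integrable (fun x : ℝ => Complex.exp (t * x * Complex.I)) ν := fun ν _ =>
    Integrable.of_bound (by fun_prop) 1 (Eventually.of_forall fun x => by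
      rw [← Complex.ofReal_mul, Complex.norm_exp_ofReal_mul_I])
  have hc : ((m : ℝ≥0∞) + 1)⁻¹ ≠ ∞ := by simp
  have hcr : ((((m : ℝ≥0∞) + 1)⁻¹).toReal : ℂ) = ((m : ℂ) + 1)⁻¹ := by
    rw [ENNReal.toReal_inv, ENNReal.toReal_add (by simp) (by simp)]
    simp
  conv_lhs => rw [hμ.eq_sum]
  rw [charFun_apply_real, integral_finsetSum_measure
    (fun i _ => (hbdd _).smul_measure hc), Finset.sum_mul]
  refine Finset.sum_congr rfl fun i _ => ?_
  rw [integral_smul_measure, integral_map (continuous_ifs f i).measurable.aemeasurable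
    (by fun_prop), charFun_apply_real, Complex.real_smul, hcr, mul_assoc]
  congr 1
  rw [← integral_const_mul]
  congr 1
  funext x
  rw [← Complex.exp_add]
  congr 1
  unfold ifs
  push_cast
  ring

/-- `cantorMeasure f` is the only self-similar measure of the iterated function system. -/
theorem eq_cantorMeasure (hp : 0 < p) {μ : Measure ℝ} (hμ : IsSelfSimilarMeasure f μ) :
    μ = cantorMeasure f := by
  have hν := isSelfSimilarMeasure_cantorMeasure f hp
  set ν := cantorMeasure f
  have h1 := hμ.isProb
  have h2 := hν.isProb
  apply Measure.ext_of_charFun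
  funext t
  have hp' : (0 : ℝ) < p := by exact_mod_cast hp
  have hw : ∀ t : ℝ, ‖∑ i : Fin (m + 1), ((m : ℂ) + 1)⁻¹ *
      Complex.exp (t * (((f i : ℕ) / (1 + (p : ℝ)) : ℝ) : ℂ) * Complex.I)‖ ≤ 1 := by
    intro t
    refine (norm_sum_le _ _).trans ?_
    have h : ∀ i : Fin (m + 1), ‖((m : ℂ) + 1)⁻¹ *
        Complex.exp (t * (((f i : ℕ) / (1 + (p : ℝ)) : ℝ) : ℂ) * Complex.I)‖ =
        ((m : ℝ) + 1)⁻¹ := by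
      intro i
      rw [norm_mul, ← Complex.ofReal_mul, Complex.norm_exp_ofReal_mul_I, mul_one, norm_inv]
      congr 1
      exact_mod_cast Complex.norm_natCast (m + 1)
    simp_rw [h]
    rw [Finset.sum_const, Finset.card_univ, Fintype.card_fin, nsmul_eq_mul]
    push_cast
    rw [mul_inv_cancel₀ (by positivity)]
  have hstep : ∀ t : ℝ, ‖charFun μ t - charFun ν t‖ ≤
      ‖charFun μ (t / (1 + (p : ℝ))) - charFun ν (t / (1 + (p : ℝ)))‖ := by
    intro t
    rw [charFun_selfSimilar f hμ, charFun_selfSimilar f hν, ← mul_sub, norm_mul]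
    exact mul_le_of_le_one_left (norm_nonneg _) (hw t)
  have hiter : ∀ n : ℕ, ‖charFun μ t - charFun ν t‖ ≤
      ‖charFun μ (t * (1 / (1 + (p : ℝ))) ^ n) - charFun ν (t * (1 / (1 + (p : ℝ))) ^ n)‖ := by
    intro n
    induction n with
    | zero => simp
    | succ n ih =>
      refine (ih.trans (hstep _)).trans_eq ?_
      rw [show t * (1 / (1 + (p : ℝ))) ^ n / (1 + (p : ℝ)) = t * (1 / (1 + (p : ℝ))) ^ (n + 1) by
        rw [pow_succ]; ring]
  have h0 : Tendsto (fun n : ℕ => t * (1 / (1 + (p : ℝ))) ^ n) atTop (𝓝 0) := by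
    simpa using (tendsto_pow_atTop_nhds_zero_of_lt_one (by positivity)
      ((div_lt_one (by positivity)).2 (by linarith : (1 : ℝ) < 1 + p))).const_mul t
  have hcont : Continuous fun t : ℝ => ‖charFun μ t - charFun ν t‖ := by
    fun_prop
  have h3 := (hcont.tendsto 0).comp h0
  rw [charFun_zero, charFun_zero, probReal_univ, probReal_univ, sub_self, norm_zero] at h3
  have h4 : ‖charFun μ t - charFun ν t‖ ≤ 0 := ge_of_tendsto h3 (Eventually.of_forall hiter)
  exact sub_eq_zero.1 (norm_le_zero_iff.1 h4)

end Facts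

end CantorIntegers

end

namespace CantorIntegers

/-! ### Digit recursion and growth of the Cantor integers -/

section Digits

variable {m p : ℕ} {f : Fin (m + 1) → Fin (p + 1)}

/-! Write F(x) = μ((-∞, x]). Iterating self-similarity k times writes F(y/(p+1)^k) as the average of
F(y - C_j) over j < (m+1)^k (`distribution_div_pow`). Since F vanishes on (-∞, 0], equals 1 on [1,
∞), and the C_j are strictly increasing integers, taking y = C_n just counts the j < n. So
F(C_n/(p+1)^k) = n/(m+1)^k when n ≤ (m+1)^k, and since (p+1)^(1/α) = m+1, the ratio n/C_n^(1/α) is a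
value of d at scaled Cantor integers (`cantorDensity_cantorInt`).

Near 0 only S_0 matters: F(x/(p+1)) = F(x)/(m+1) for x ≤ 1, so d is unchanged by x ↦ x/(p+1) on (0,
1]. Hence d((0, 1]) = d([1/(p+1), 1]), a compact interval [A, B] with A > 0 because F is continuous.
Each of its values recurs along x/(p+1)^n → 0, so it is Λ_0 and its endpoints are the two densities.

The ratios lie in [A, B]. Conversely, x is squeezed between consecutive points C_l/(p+1)^k, across
which F grows by (m+1)^(-k); letting k → ∞ identifies A and B with the infimum and supremum of the
ratios (`isGLB_isLUB_cantorInt_ratio`). The decreasing map t ↦ t^(-1/α) carries C_n/n^α to these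
ratios. -/

theorem cantorInt_zero : cantorInt f 0 = 0 := by simp [cantorInt]

theorem cantorInt_add_mul (hm : 1 ≤ m) (hf0 : f 0 = 0) (i : Fin (m + 1)) (n : ℕ) :
    cantorInt f (i + (m + 1) * n) = f i + (p + 1) * cantorInt f n := by
  -- The number 0 has no digits at all, so prepending the digit 0 to it is consistent only because
  -- f(0) = 0.
  by_cases h : (i : ℕ) = 0 ∧ n = 0
  · obtain ⟨h1, rfl⟩ := h
    have hi : i = 0 := Fin.ext h1
    subst hi
    simp [cantorInt, hf0]
  · unfold cantorInt
    rw [Nat.digits_add (m + 1) (by omega) i n i.2 (by tauto), List.map_cons, Nat.ofDigits_cons]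
    simp

theorem exists_eq_add_mul (n : ℕ) : ∃ (i : Fin (m + 1)) (k : ℕ), n = i + (m + 1) * k :=
  ⟨⟨n % (m + 1), Nat.mod_lt _ (by omega)⟩, n / (m + 1), (Nat.mod_add_div n (m + 1)).symm⟩

/-- Compare quotients by m+1 first: a gap of at least 1 between the C-values of the quotients, times
p+1, outweighs any last digit f(i) ≤ p. Equal quotients leave the comparison to f. -/
theorem strictMono_cantorInt (hm : 1 ≤ m) (hf : StrictMono f) (hf0 : f 0 = 0) :
    StrictMono (cantorInt f) := by
  intro a b
  induction b using Nat.strong_induction_on generalizing a with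
  | _ b ih =>
    intro hab
    obtain ⟨i, k, rfl⟩ := exists_eq_add_mul (m := m) a
    obtain ⟨j, l, rfl⟩ := exists_eq_add_mul (m := m) b
    rw [cantorInt_add_mul hm hf0, cantorInt_add_mul hm hf0]
    have hi := i.2
    have hj := j.2
    have hfi := (f i).2
    rcases lt_trichotomy k l with hkl | rfl | hkl
    · have h := ih l (by nlinarith) hkl
      nlinarith
    · have h : i < j := by rw [Fin.lt_def]; omega
      have := Fin.lt_def.1 (hf h)
      omega
    · nlinarith

theorem cantorInt_pos (hm : 1 ≤ m) (hf : StrictMono f) (hf0 : f 0 = 0) {n : ℕ} (hn : 0 < n) :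
    0 < cantorInt f n := by
  simpa [cantorInt_zero] using strictMono_cantorInt hm hf hf0 hn

/-- Ensures that C_l < (p+1)^k forces l < (m+1)^k, so that level k of the construction sees the
index l. -/
theorem pow_le_cantorInt_pow (hm : 1 ≤ m) (hf : StrictMono f) (hf0 : f 0 = 0) (k : ℕ) :
    (p + 1) ^ k ≤ cantorInt f ((m + 1) ^ k) := by
  induction k with
  | zero => simpa using Nat.succ_le_of_lt (cantorInt_pos hm hf hf0 one_pos)
  | succ k ih =>
    have h := cantorInt_add_mul hm hf0 0 ((m + 1) ^ k)
    rw [Fin.val_zero, zero_add] at h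
    rw [pow_succ', pow_succ', h]
    nlinarith

end Digits

/-- Splits an index into its last base-b digit and the rest, to match `cantorInt_add_mul`. -/
theorem sum_range_mul_eq {M : Type*} [AddCommMonoid M] (g : ℕ → M) (b n : ℕ) :
    ∑ j ∈ Finset.range (b * n), g j = ∑ j ∈ Finset.range n, ∑ i : Fin b, g (i + b * j) := by
  induction n with
  | zero => simp
  | succ n ih =>
    rw [Nat.mul_succ, Finset.sum_range_add, ih, Finset.sum_range_succ,
      Finset.sum_range fun i => g (b * n + i)]
    simp_rw [add_comm (b * n)]

/-! ### The distribution function of the Cantor measure -/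

section Distribution

variable {m p : ℕ} {f : Fin (m + 1) → Fin (p + 1)} {μ : Measure ℝ}

theorem distribution_eq_sum (hμ : IsSelfSimilarMeasure f μ) (x : ℝ) :
    μ.real (Iic x) = ((m : ℝ) + 1)⁻¹ * ∑ i, μ.real (Iic (x * ((p : ℝ) + 1) - (f i : ℕ))) := by
  have hprob := hμ.isProb
  have hpre : ∀ i, ifs f i ⁻¹' Iic x = Iic (x * ((p : ℝ) + 1) - (f i : ℕ)) := by
    intro i
    ext y
    simp only [mem_preimage, mem_Iic, ifs]
    rw [div_le_iff₀ (by positivity), add_comm (1 : ℝ), le_sub_iff_add_le]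
  have hinv : (((m : ENNReal) + 1)⁻¹).toReal = ((m : ℝ) + 1)⁻¹ := by
    rw [ENNReal.toReal_inv, ENNReal.toReal_add (by simp) (by simp)]
    simp
  conv_lhs => rw [measureReal_def, hμ.eq_sum]
  rw [Measure.finsetSum_apply, ENNReal.toReal_sum]
  · rw [Finset.mul_sum]
    refine Finset.sum_congr rfl fun i _ => ?_
    rw [Measure.smul_apply, Measure.map_apply (continuous_ifs f i).measurable measurableSet_Iic,
      hpre, smul_eq_mul, ENNReal.toReal_mul, hinv, measureReal_def]
  · intro i _
    rw [Measure.smul_apply, Measure.map_apply (continuous_ifs f i).measurable measurableSet_Iic]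
    exact ENNReal.mul_ne_top (by simp) (measure_ne_top _ _)

theorem distribution_div_pow (hm : 1 ≤ m) (hf0 : f 0 = 0) (hμ : IsSelfSimilarMeasure f μ)
    (k : ℕ) (y : ℝ) :
    μ.real (Iic (y / ((p : ℝ) + 1) ^ k)) =
      (((m : ℝ) + 1) ^ k)⁻¹ * ∑ j ∈ Finset.range ((m + 1) ^ k),
        μ.real (Iic (y - cantorInt f j)) := by
  induction k generalizing y with
  | zero => simp [cantorInt_zero]
  | succ k ih =>
    have hq : (p : ℝ) + 1 ≠ 0 := by positivity
    rw [pow_succ' ((p : ℝ) + 1), ← div_div, ih, pow_succ' (m + 1), sum_range_mul_eq,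
      pow_succ ((m : ℝ) + 1), mul_inv, mul_assoc, Finset.mul_sum (a := ((m : ℝ) + 1)⁻¹)]
    congr 1
    refine Finset.sum_congr rfl fun j _ => ?_
    rw [distribution_eq_sum hμ]
    congr 1
    refine Finset.sum_congr rfl fun i _ => ?_
    rw [cantorInt_add_mul hm hf0]
    congr 2
    push_cast
    field_simp
    ring

theorem coding_mem_Icc (hp : 0 < p) (ω : ℕ → Fin (m + 1)) : coding f ω ∈ Icc (0 : ℝ) 1 := by
  have hp' : (0 : ℝ) < p := by exact_mod_cast hp
  have hs := Summable.of_norm_bounded (summable_bound hp) (term_bound f ω)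
  refine ⟨tsum_nonneg fun k => by positivity, ?_⟩
  refine (hs.tsum_le_tsum (fun k => (le_abs_self _).trans (term_bound f ω k))
    (summable_bound hp)).trans_eq ?_
  simp_rw [pow_succ]
  rw [tsum_mul_left, tsum_mul_right, tsum_geometric_of_lt_one (by positivity)
    ((div_lt_one (by positivity)).2 (by linarith))]
  have : (1 : ℝ) - 1 / (1 + p) = p / (1 + p) := by field_simp; ring
  rw [this]
  field_simp

theorem cantorMeasure_distribution_of_neg (hp : 0 < p) {x : ℝ} (hx : x < 0) :
    (cantorMeasure f).real (Iic x) = 0 := by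
  rw [cantorMeasure, map_measureReal_apply (continuous_coding f hp).measurable measurableSet_Iic]
  have : coding f ⁻¹' Iic x = ∅ := by
    ext ω
    have := (coding_mem_Icc (f := f) hp ω).1
    simp only [mem_preimage, mem_Iic, mem_empty_iff_false, iff_false, not_le]
    linarith
  rw [this, measureReal_empty]

theorem cantorMeasure_distribution_of_one_le (hp : 0 < p) {x : ℝ} (hx : 1 ≤ x) :
    (cantorMeasure f).real (Iic x) = 1 := by
  rw [cantorMeasure, map_measureReal_apply (continuous_coding f hp).measurable measurableSet_Iic]
  have : coding f ⁻¹' Iic x = univ := by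
    ext ω
    have := (coding_mem_Icc (f := f) hp ω).2
    simp only [mem_preimage, mem_Iic, mem_univ, iff_true]
    linarith
  rw [this, probReal_univ]

/-- There is no atom at 0: only i = 0 contributes to the self-similar equation there, so F(0) =
F(0)/(m+1) with m ≥ 1. -/
theorem cantorMeasure_distribution_of_nonpos (hm : 1 ≤ m) (hp : 0 < p) (hf : StrictMono f)
    (hf0 : f 0 = 0) {x : ℝ} (hx : x ≤ 0) : (cantorMeasure f).real (Iic x) = 0 := by
  rcases hx.lt_or_eq with hx | rfl
  · exact cantorMeasure_distribution_of_neg hp hx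
  have h := distribution_eq_sum (isSelfSimilarMeasure_cantorMeasure f hp) 0
  rw [Finset.sum_eq_single 0] at h
  · simp only [zero_mul, hf0, Fin.val_zero, Nat.cast_zero, sub_zero] at h
    have hm' : (1 : ℝ) ≤ m := by exact_mod_cast hm
    rw [inv_mul_eq_div, eq_div_iff (by positivity)] at h
    nlinarith
  · intro i _ hi
    apply cantorMeasure_distribution_of_neg hp
    have h1 : 0 < (f i : ℕ) := by
      have := Fin.lt_def.1 (hf (Fin.pos_iff_ne_zero.2 hi))
      rwa [hf0] at this
    have h2 : (0 : ℝ) < (f i : ℕ) := by exact_mod_cast h1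
    linarith
  · simp

theorem cantorMeasure_Icc_zero (hp : 0 < p) (x : ℝ) :
    (cantorMeasure f).real (Icc 0 x) = (cantorMeasure f).real (Iic x) := by
  have hc := (continuous_coding f hp).measurable
  rw [cantorMeasure, map_measureReal_apply hc measurableSet_Iic,
    map_measureReal_apply hc measurableSet_Icc]
  congr 1
  ext ω
  simp [(coding_mem_Icc (f := f) hp ω).1]

/-- Integer gaps make each F(C_n - C_j) equal to 0 or 1. The minimum appears because only (m+1)^k
indices j occur at level k. -/
theorem cantorMeasure_distribution_cantorInt (hm : 1 ≤ m) (hp : 0 < p) (hf : StrictMono f)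
    (hf0 : f 0 = 0) (n k : ℕ) :
    (cantorMeasure f).real (Iic ((cantorInt f n : ℝ) / ((p : ℝ) + 1) ^ k)) =
      min n ((m + 1) ^ k) / ((m : ℝ) + 1) ^ k := by
  have hC := strictMono_cantorInt hm hf hf0
  rw [distribution_div_pow hm hf0 (isSelfSimilarMeasure_cantorMeasure f hp)]
  have h : ∀ j, (cantorMeasure f).real (Iic ((cantorInt f n : ℝ) - cantorInt f j)) =
      if j < n then 1 else 0 := by
    intro j
    split_ifs with hj
    · apply cantorMeasure_distribution_of_one_le hp
      have : cantorInt f j + 1 ≤ cantorInt f n := hC hj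
      have : (cantorInt f j : ℝ) + 1 ≤ cantorInt f n := by exact_mod_cast this
      linarith
    · apply cantorMeasure_distribution_of_nonpos hm hp hf hf0
      have : (cantorInt f n : ℝ) ≤ cantorInt f j := by exact_mod_cast hC.monotone (not_lt.1 hj)
      linarith
  simp_rw [h]
  rw [Finset.sum_ite, Finset.sum_const_zero, add_zero, Finset.sum_const, nsmul_one,
    inv_mul_eq_div]
  have h2 : (Finset.range ((m + 1) ^ k)).filter (· < n) = Finset.range (min n ((m + 1) ^ k)) := by
    ext j
    simp only [Finset.mem_filter, Finset.mem_range, lt_min_iff]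
    tauto
  rw [h2, Finset.card_range]

/-- The C_j are at least 1 apart, so the intervals (z - C_j, y - C_j] are disjoint and their masses
add up to at most 1. This modulus of continuity gives the continuity of F. -/
theorem cantorMeasure_distribution_sub_le (hm : 1 ≤ m) (hp : 0 < p) (hf : StrictMono f)
    (hf0 : f 0 = 0) (k : ℕ) {y z : ℝ} (hzy : z ≤ y) (hyz : y ≤ z + 1) :
    (cantorMeasure f).real (Iic (y / ((p : ℝ) + 1) ^ k)) -
      (cantorMeasure f).real (Iic (z / ((p : ℝ) + 1) ^ k)) ≤ (((m : ℝ) + 1) ^ k)⁻¹ := by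
  have hμ := isSelfSimilarMeasure_cantorMeasure f hp
  have hprob := hμ.isProb
  have hC := strictMono_cantorInt hm hf hf0
  rw [distribution_div_pow hm hf0 hμ, distribution_div_pow hm hf0 hμ, ← mul_sub,
    ← Finset.sum_sub_distrib]
  refine mul_le_of_le_one_right (by positivity) ?_
  have h : ∀ j, (cantorMeasure f).real (Iic (y - cantorInt f j)) -
      (cantorMeasure f).real (Iic (z - cantorInt f j)) =
      (cantorMeasure f).real (Ioc (z - cantorInt f j) (y - cantorInt f j)) := by
    intro j
    rw [← Iic_sdiff_Iic, measureReal_sdiff (Iic_subset_Iic.2 (by linarith)) measurableSet_Iic]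
  simp_rw [h]
  rw [← measureReal_biUnion_finset]
  · exact measureReal_le_one
  · intro i _ j _ hij
    refine Set.disjoint_left.2 fun x hx hx' => ?_
    simp only [mem_Ioc] at hx hx'
    rcases hij.lt_or_gt with h | h
    · have : (cantorInt f i : ℝ) + 1 ≤ cantorInt f j := by exact_mod_cast hC h
      linarith [hx.1, hx'.2]
    · have : (cantorInt f j : ℝ) + 1 ≤ cantorInt f i := by exact_mod_cast hC h
      linarith [hx'.1, hx.2]
  · exact fun _ _ => measurableSet_Ioc

theorem continuous_cantorMeasure_distribution (hm : 1 ≤ m) (hp : 0 < p) (hf : StrictMono f)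
    (hf0 : f 0 = 0) : Continuous fun x => (cantorMeasure f).real (Iic x) := by
  have hprob := (isSelfSimilarMeasure_cantorMeasure f hp).isProb
  have hmono : Monotone fun x => (cantorMeasure f).real (Iic x) := fun x y h =>
    measureReal_mono (Iic_subset_Iic.2 h)
  have hm' : (1 : ℝ) ≤ m := by exact_mod_cast hm
  rw [Metric.continuous_iff]
  intro x ε hε
  obtain ⟨k, hk⟩ := exists_pow_lt_of_lt_one hε
    (inv_lt_one_of_one_lt₀ (by linarith : (1 : ℝ) < (m : ℝ) + 1))
  rw [inv_pow] at hk
  have key : ∀ y z : ℝ, z ≤ y → y - z < (((p : ℝ) + 1) ^ k)⁻¹ →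
      (cantorMeasure f).real (Iic y) - (cantorMeasure f).real (Iic z) < ε := by
    intro y z hzy hyz
    have hQ : (0 : ℝ) < ((p : ℝ) + 1) ^ k := by positivity
    have h1 := cantorMeasure_distribution_sub_le hm hp hf hf0 k
      (y := y * ((p : ℝ) + 1) ^ k) (z := z * ((p : ℝ) + 1) ^ k) (by gcongr) (by
        rw [← one_div, lt_div_iff₀ hQ] at hyz
        linarith)
    rw [mul_div_cancel_right₀ _ hQ.ne', mul_div_cancel_right₀ _ hQ.ne'] at h1
    exact h1.trans_lt hk
  refine ⟨(((p : ℝ) + 1) ^ k)⁻¹, by positivity, fun y hy => ?_⟩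
  rw [Real.dist_eq] at hy ⊢
  rcases le_total x y with h | h
  · rw [abs_of_nonneg (sub_nonneg.2 h)] at hy
    rw [abs_of_nonneg (sub_nonneg.2 (hmono h))]
    exact key y x h hy
  · rw [abs_sub_comm, abs_of_nonneg (sub_nonneg.2 h)] at hy
    rw [abs_sub_comm, abs_of_nonneg (sub_nonneg.2 (hmono h))]
    exact key x y h hy

/-- For i ≠ 0 one has x - f(i) ≤ 0, so only the branch S_0 has mass here. -/
theorem cantorMeasure_distribution_div (hm : 1 ≤ m) (hp : 0 < p) (hf : StrictMono f)
    (hf0 : f 0 = 0) {x : ℝ} (hx : x ≤ 1) :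
    (cantorMeasure f).real (Iic (x / ((p : ℝ) + 1))) =
      (cantorMeasure f).real (Iic x) / ((m : ℝ) + 1) := by
  rw [distribution_eq_sum (isSelfSimilarMeasure_cantorMeasure f hp),
    div_mul_cancel₀ _ (by positivity), inv_mul_eq_div, Finset.sum_eq_single 0]
  · simp [hf0]
  · intro i _ hi
    apply cantorMeasure_distribution_of_nonpos hm hp hf hf0
    have h1 : 0 < (f i : ℕ) := by
      have := Fin.lt_def.1 (hf (Fin.pos_iff_ne_zero.2 hi))
      rwa [hf0] at this
    have h2 : (1 : ℝ) ≤ (f i : ℕ) := by exact_mod_cast h1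
    linarith
  · simp

end Distribution

/-! ### The density at 0 and its range of values -/

section Density

variable {m p : ℕ} {f : Fin (m + 1) → Fin (p + 1)}

theorem alpha_pos (hm : 1 ≤ m) (hp : 0 < p) : 0 < alpha m p := by
  have hm' : (1 : ℝ) ≤ m := by exact_mod_cast hm
  have hp' : (1 : ℝ) ≤ p := by exact_mod_cast hp
  exact Real.logb_pos (by linarith) (by linarith)

theorem rpow_one_div_alpha (hm : 1 ≤ m) (hp : 0 < p) :
    ((p : ℝ) + 1) ^ (1 / alpha m p) = (m : ℝ) + 1 := by
  have hm' : (1 : ℝ) ≤ m := by exact_mod_cast hm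
  have h : ((m : ℝ) + 1) ^ alpha m p = (p : ℝ) + 1 :=
    Real.rpow_logb (by positivity) (by linarith) (by positivity)
  rw [← h, ← Real.rpow_mul (by positivity), mul_one_div_cancel (alpha_pos hm hp).ne',
    Real.rpow_one]

theorem div_pow_rpow_one_div_alpha (hm : 1 ≤ m) (hp : 0 < p) {x : ℝ} (hx : 0 ≤ x) (k : ℕ) :
    (x / ((p : ℝ) + 1) ^ k) ^ (1 / alpha m p) = x ^ (1 / alpha m p) / ((m : ℝ) + 1) ^ k := by
  rw [Real.div_rpow hx (by positivity), ← Real.rpow_pow_comm (by positivity),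
    rpow_one_div_alpha hm hp]

/-- The density function `x ↦ μ([0,x]) / x^(1/α)` of the Cantor measure. -/
noncomputable abbrev cantorDensity (f : Fin (m + 1) → Fin (p + 1)) : ℝ → ℝ :=
  density (cantorMeasure f) (1 / alpha m p)

theorem cantorDensity_eq (hp : 0 < p) (x : ℝ) :
    cantorDensity f x = (cantorMeasure f).real (Iic x) / x ^ (1 / alpha m p) := by
  rw [cantorDensity, density, cantorMeasure_Icc_zero hp]

theorem cantorDensity_div_pow (hm : 1 ≤ m) (hp : 0 < p) (hf : StrictMono f) (hf0 : f 0 = 0)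
    {x : ℝ} (hx0 : 0 ≤ x) (hx : x ≤ 1) (k : ℕ) :
    cantorDensity f (x / ((p : ℝ) + 1) ^ k) = cantorDensity f x := by
  have h : (cantorMeasure f).real (Iic (x / ((p : ℝ) + 1) ^ k)) =
      (cantorMeasure f).real (Iic x) / ((m : ℝ) + 1) ^ k := by
    induction k with
    | zero => simp
    | succ k ih =>
      rw [pow_succ, ← div_div, cantorMeasure_distribution_div hm hp hf hf0, ih, pow_succ, div_div]
      exact (div_le_self hx0 (one_le_pow₀ (by linarith [Nat.cast_nonneg (α := ℝ) p]))).trans hx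
  rw [cantorDensity_eq hp, cantorDensity_eq hp, h, div_pow_rpow_one_div_alpha hm hp hx0,
    div_div_div_cancel_right₀ (by positivity)]

theorem cantorDensity_cantorInt (hm : 1 ≤ m) (hp : 0 < p) (hf : StrictMono f) (hf0 : f 0 = 0)
    {n k : ℕ} (hn : n ≤ (m + 1) ^ k) :
    cantorDensity f (cantorInt f n / ((p : ℝ) + 1) ^ k) =
      n / (cantorInt f n : ℝ) ^ (1 / alpha m p) := by
  rw [cantorDensity_eq hp, div_pow_rpow_one_div_alpha hm hp (by positivity),
    cantorMeasure_distribution_cantorInt hm hp hf hf0, min_eq_left hn,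
    div_div_div_cancel_right₀ (by positivity)]

/-- [1/(p+1), 1] meets every orbit of the scaling invariance in (0, 1]; being compact and away from
0, it makes the range a closed interval. -/
theorem image_cantorDensity_Ioc (hm : 1 ≤ m) (hp : 0 < p) (hf : StrictMono f) (hf0 : f 0 = 0) :
    cantorDensity f '' Ioc 0 1 = cantorDensity f '' Icc (1 / ((p : ℝ) + 1)) 1 := by
  have hp' : (1 : ℝ) ≤ p := by exact_mod_cast hp
  apply Subset.antisymm
  · rintro _ ⟨x, ⟨hx0, hx1⟩, rfl⟩
    obtain ⟨k, hk1, hk2⟩ := exists_nat_pow_near (one_le_inv_iff₀.2 ⟨hx0, hx1⟩)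
      (by linarith : (1 : ℝ) < (p : ℝ) + 1)
    have hQ : (0 : ℝ) < ((p : ℝ) + 1) ^ k := by positivity
    have h1 : x * ((p : ℝ) + 1) ^ k ≤ 1 := by
      calc x * ((p : ℝ) + 1) ^ k ≤ x * x⁻¹ := by gcongr
        _ = 1 := mul_inv_cancel₀ hx0.ne'
    refine ⟨x * ((p : ℝ) + 1) ^ k, ⟨?_, h1⟩, ?_⟩
    · rw [div_le_iff₀ (by positivity), mul_assoc, ← pow_succ]
      calc 1 = x * x⁻¹ := (mul_inv_cancel₀ hx0.ne').symm
        _ ≤ _ := by gcongr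
    · rw [← cantorDensity_div_pow hm hp hf hf0 (by positivity) h1 k,
        mul_div_cancel_right₀ _ hQ.ne']
  · exact image_mono fun x hx => ⟨lt_of_lt_of_le (by positivity) hx.1, hx.2⟩

theorem continuousOn_cantorDensity (hm : 1 ≤ m) (hp : 0 < p) (hf : StrictMono f) (hf0 : f 0 = 0) :
    ContinuousOn (cantorDensity f) (Ioi 0) := by
  have h : cantorDensity f = fun x => (cantorMeasure f).real (Iic x) / x ^ (1 / alpha m p) :=
    funext (cantorDensity_eq hp)
  rw [h]
  refine (continuous_cantorMeasure_distribution hm hp hf hf0).continuousOn.div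
    (fun x hx => ?_) fun x hx => (Real.rpow_pos_of_pos hx _).ne'
  exact (Real.continuousAt_rpow_const x _ (Or.inl (ne_of_gt hx))).continuousWithinAt

/-- The values of the density function on `(0,1]` form a compact interval in `(0,∞)`. -/
theorem exists_image_cantorDensity_eq_Icc (hm : 1 ≤ m) (hp : 0 < p) (hf : StrictMono f)
    (hf0 : f 0 = 0) : ∃ A B : ℝ, 0 < A ∧ A ≤ B ∧ cantorDensity f '' Ioc 0 1 = Icc A B := by
  have hp' : (1 : ℝ) ≤ p := by exact_mod_cast hp
  have hprob := (isSelfSimilarMeasure_cantorMeasure f hp).isProb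
  have hle : 1 / ((p : ℝ) + 1) ≤ 1 := (div_le_one (by positivity)).2 (by linarith)
  have himg := ContinuousOn.image_Icc hle
    ((continuousOn_cantorDensity hm hp hf hf0).mono fun x hx =>
      lt_of_lt_of_le (by positivity : 0 < 1 / ((p : ℝ) + 1)) hx.1)
  rw [← image_cantorDensity_Ioc hm hp hf hf0] at himg
  set A := sInf (cantorDensity f '' Ioc 0 1)
  set B := sSup (cantorDensity f '' Ioc 0 1)
  have hAB : A ≤ B := nonempty_Icc.1 (himg ▸ (nonempty_Ioc.2 one_pos).image _)
  refine ⟨A, B, ?_, hAB, himg⟩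
  have hA : A ∈ cantorDensity f '' Icc (1 / ((p : ℝ) + 1)) 1 := by
    rw [← image_cantorDensity_Ioc hm hp hf hf0, himg]
    exact left_mem_Icc.2 hAB
  obtain ⟨x, hx, hxA⟩ := hA
  have hx0 : 0 < x := lt_of_lt_of_le (by positivity) hx.1
  rw [← hxA, cantorDensity_eq hp]
  -- F(x) ≥ F(1/(p+1)) = 1/(m+1) on the fundamental interval.
  refine div_pos (lt_of_lt_of_le ?_ (measureReal_mono (Iic_subset_Iic.2 hx.1)))
    (Real.rpow_pos_of_pos hx0 _)
  rw [cantorMeasure_distribution_div hm hp hf hf0 le_rfl,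
    cantorMeasure_distribution_of_one_le hp le_rfl]
  positivity

theorem cantorInt_ratio_mem (hm : 1 ≤ m) (hp : 0 < p) (hf : StrictMono f) (hf0 : f 0 = 0)
    {n : ℕ} (hn : 0 < n) :
    (n : ℝ) / (cantorInt f n : ℝ) ^ (1 / alpha m p) ∈ cantorDensity f '' Ioc 0 1 := by
  have hp' : (1 : ℝ) ≤ p := by exact_mod_cast hp
  -- This k makes both n ≤ (m+1)^k and C_n ≤ (p+1)^k, as both bases are at least 2.
  have hk : max n (cantorInt f n) < 2 ^ max n (cantorInt f n) := Nat.lt_two_pow_self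
  set k := max n (cantorInt f n)
  have hC : (0 : ℝ) < cantorInt f n := by exact_mod_cast cantorInt_pos hm hf hf0 hn
  refine ⟨cantorInt f n / ((p : ℝ) + 1) ^ k, ⟨by positivity, ?_⟩, ?_⟩
  · rw [div_le_one (by positivity)]
    have : cantorInt f n ≤ (p + 1) ^ k := (le_max_right _ _).trans
      (hk.le.trans (Nat.pow_le_pow_left (by omega) k))
    exact_mod_cast this
  · exact cantorDensity_cantorInt hm hp hf hf0 ((le_max_left _ _).trans
      (hk.le.trans (Nat.pow_le_pow_left (by omega) k)))

theorem exists_cantorInt_le_lt (hm : 1 ≤ m) (hf : StrictMono f) (hf0 : f 0 = 0) {y : ℝ}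
    (hy : 0 ≤ y) : ∃ l : ℕ, (cantorInt f l : ℝ) ≤ y ∧ y < cantorInt f (l + 1) := by
  classical
  have hC := strictMono_cantorInt hm hf hf0
  have hex : ∃ n, y < cantorInt f n := by
    obtain ⟨n, hn⟩ := exists_nat_gt y
    exact ⟨n, hn.trans_le (by exact_mod_cast hC.le_apply)⟩
  obtain ⟨l, hl⟩ : ∃ l, Nat.find hex = l + 1 := by
    refine Nat.exists_eq_succ_of_ne_zero fun h => ?_
    have := Nat.find_spec hex
    rw [h, cantorInt_zero, Nat.cast_zero] at this
    linarith
  exact ⟨l, not_lt.1 (Nat.find_min hex (by omega)), hl ▸ Nat.find_spec hex⟩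

/-- Every value of the density function is approximated from above and from below by the ratios
`n / C_n^(1/α)`. -/
theorem exists_cantorDensity_approx (hm : 1 ≤ m) (hp : 0 < p) (hf : StrictMono f) (hf0 : f 0 = 0)
    {x : ℝ} (hx0 : 0 < x) (hx1 : x < 1) (k : ℕ) : ∃ l : ℕ,
      cantorDensity f x ≤ l / (cantorInt f l : ℝ) ^ (1 / alpha m p) +
        (x ^ (1 / alpha m p))⁻¹ * (((m : ℝ) + 1)⁻¹) ^ k ∧
      ((l + 1 : ℕ) : ℝ) / (cantorInt f (l + 1) : ℝ) ^ (1 / alpha m p) -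
        (x ^ (1 / alpha m p))⁻¹ * (((m : ℝ) + 1)⁻¹) ^ k ≤ cantorDensity f x := by
  have hprob := (isSelfSimilarMeasure_cantorMeasure f hp).isProb
  have hC := strictMono_cantorInt hm hf hf0
  have hQ : (0 : ℝ) < ((p : ℝ) + 1) ^ k := by positivity
  have hM : (0 : ℝ) < ((m : ℝ) + 1) ^ k := by positivity
  have hα := alpha_pos hm hp
  obtain ⟨l, hl1, hl2⟩ := exists_cantorInt_le_lt hm hf hf0 (y := x * ((p : ℝ) + 1) ^ k)
    (by positivity)
  have hl : l < (m + 1) ^ k := by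
    rw [← hC.lt_iff_lt]
    have h1 : (((p + 1) ^ k : ℕ) : ℝ) ≤ cantorInt f ((m + 1) ^ k) := by
      exact_mod_cast pow_le_cantorInt_pow hm hf hf0 k
    have h2 : (cantorInt f l : ℝ) < cantorInt f ((m + 1) ^ k) := by
      push_cast at h1
      nlinarith
    exact_mod_cast h2
  have hF1 := cantorMeasure_distribution_cantorInt hm hp hf hf0 l k
  have hF2 := cantorMeasure_distribution_cantorInt hm hp hf hf0 (l + 1) k
  rw [min_eq_left hl.le] at hF1
  rw [min_eq_left (Nat.succ_le_of_lt hl)] at hF2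
  have hle1 : (cantorInt f l : ℝ) / ((p : ℝ) + 1) ^ k ≤ x := (div_le_iff₀ hQ).2 hl1
  have hle2 : x ≤ (cantorInt f (l + 1) : ℝ) / ((p : ℝ) + 1) ^ k := (le_div_iff₀ hQ).2 hl2.le
  have hF1' : (l : ℝ) / ((m : ℝ) + 1) ^ k ≤ (cantorMeasure f).real (Iic x) :=
    hF1 ▸ measureReal_mono (Iic_subset_Iic.2 hle1)
  have hF2' : (cantorMeasure f).real (Iic x) ≤ ((l + 1 : ℕ) : ℝ) / ((m : ℝ) + 1) ^ k :=
    hF2 ▸ measureReal_mono (Iic_subset_Iic.2 hle2)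
  have hX : 0 < x ^ (1 / alpha m p) := Real.rpow_pos_of_pos hx0 _
  have hX1 := Real.rpow_le_rpow (by positivity) hle1 (one_div_nonneg.2 hα.le)
  have hX2 := Real.rpow_le_rpow hx0.le hle2 (one_div_nonneg.2 hα.le)
  rw [div_pow_rpow_one_div_alpha hm hp (by positivity)] at hX1 hX2
  have heq : ((l + 1 : ℕ) : ℝ) / ((m : ℝ) + 1) ^ k / x ^ (1 / alpha m p) =
      (l : ℝ) / ((m : ℝ) + 1) ^ k / x ^ (1 / alpha m p) +
        (x ^ (1 / alpha m p))⁻¹ * (((m : ℝ) + 1)⁻¹) ^ k := by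
    push_cast
    rw [inv_pow]
    field_simp
  refine ⟨l, ?_, ?_⟩
  · rw [cantorDensity_eq hp]
    have h1 : (l : ℝ) / ((m : ℝ) + 1) ^ k / x ^ (1 / alpha m p) ≤
        l / (cantorInt f l : ℝ) ^ (1 / alpha m p) := by
      -- At l = 0 both sides are 0, the right one through the convention 0/0 = 0.
      rcases Nat.eq_zero_or_pos l with rfl | h0
      · simp
      · have hCl : (0 : ℝ) < cantorInt f l := by exact_mod_cast cantorInt_pos hm hf hf0 h0
        have hCs := Real.rpow_pos_of_pos hCl (1 / alpha m p)
        rw [div_div]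
        exact div_le_div_of_nonneg_left (by positivity) hCs ((div_le_iff₀' hM).1 hX1)
    calc _ ≤ ((l + 1 : ℕ) : ℝ) / ((m : ℝ) + 1) ^ k / x ^ (1 / alpha m p) := by gcongr
      _ ≤ _ := by rw [heq]; gcongr
  · rw [cantorDensity_eq hp]
    have h1 : ((l + 1 : ℕ) : ℝ) / (cantorInt f (l + 1) : ℝ) ^ (1 / alpha m p) ≤
        ((l + 1 : ℕ) : ℝ) / ((m : ℝ) + 1) ^ k / x ^ (1 / alpha m p) := by
      rw [div_div]
      exact div_le_div_of_nonneg_left (by positivity) (by positivity) ((le_div_iff₀' hM).1 hX2)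
    rw [heq] at h1
    have h2 : (l : ℝ) / ((m : ℝ) + 1) ^ k / x ^ (1 / alpha m p) ≤
        (cantorMeasure f).real (Iic x) / x ^ (1 / alpha m p) := by gcongr
    linarith

/-- The values of the density function on `(0,1]` fill the interval between the infimum and the
supremum of the ratios `n / C_n^(1/α)`. -/
theorem isGLB_isLUB_cantorInt_ratio (hm : 1 ≤ m) (hp : 0 < p) (hf : StrictMono f) (hf0 : f 0 = 0)
    {A B : ℝ} (hA : 0 < A) (hAB : A ≤ B) (himg : cantorDensity f '' Ioc 0 1 = Icc A B) :
    IsGLB (range fun n : ℕ+ => (n : ℝ) / (cantorInt f n : ℝ) ^ (1 / alpha m p)) A ∧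
      IsLUB (range fun n : ℕ+ => (n : ℝ) / (cantorInt f n : ℝ) ^ (1 / alpha m p)) B := by
  have hp' : (1 : ℝ) ≤ p := by exact_mod_cast hp
  have hm' : (1 : ℝ) ≤ m := by exact_mod_cast hm
  have hmem : ∀ n : ℕ+, (n : ℝ) / (cantorInt f n : ℝ) ^ (1 / alpha m p) ∈ Icc A B := fun n =>
    himg ▸ cantorInt_ratio_mem hm hp hf hf0 n.pos
  -- One extra division by p+1 moves the point strictly below 1, as the approximation requires.
  have hval : ∀ y ∈ Icc A B, ∃ x, 0 < x ∧ x < 1 ∧ cantorDensity f x = y := by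
    intro y hy
    rw [← himg] at hy
    obtain ⟨x, hx, rfl⟩ := hy
    refine ⟨x / ((p : ℝ) + 1) ^ 1, div_pos hx.1 (by positivity), ?_,
      cantorDensity_div_pow hm hp hf hf0 hx.1.le hx.2 1⟩
    rw [pow_one, div_lt_one (by positivity)]
    linarith [hx.2]
  have hlim : ∀ c : ℝ, Tendsto (fun k : ℕ => c * (((m : ℝ) + 1)⁻¹) ^ k) atTop (𝓝 0) := by
    intro c
    simpa using (tendsto_pow_atTop_nhds_zero_of_lt_one (by positivity)
      (inv_lt_one_of_one_lt₀ (by linarith : (1 : ℝ) < (m : ℝ) + 1))).const_mul c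
  refine ⟨⟨?_, fun L hL => ?_⟩, ⟨?_, fun U hU => ?_⟩⟩
  · rintro _ ⟨n, rfl⟩
    exact (hmem n).1
  · obtain ⟨x, hx0, hx1, hxA⟩ := hval A (left_mem_Icc.2 hAB)
    have h : Tendsto (fun k : ℕ => L - (x ^ (1 / alpha m p))⁻¹ * (((m : ℝ) + 1)⁻¹) ^ k) atTop
        (𝓝 L) := by
      simpa using (hlim (x ^ (1 / alpha m p))⁻¹).const_sub L
    refine le_of_tendsto' h fun k => ?_
    obtain ⟨l, -, hl⟩ := exists_cantorDensity_approx hm hp hf hf0 hx0 hx1 k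
    have h1 := hL ⟨⟨l + 1, l.succ_pos⟩, rfl⟩
    rw [← hxA]
    simp only [PNat.mk_coe] at h1
    linarith
  · rintro _ ⟨n, rfl⟩
    exact (hmem n).2
  · obtain ⟨x, hx0, hx1, hxB⟩ := hval B (right_mem_Icc.2 hAB)
    have h : Tendsto (fun k : ℕ => U + (x ^ (1 / alpha m p))⁻¹ * (((m : ℝ) + 1)⁻¹) ^ k) atTop
        (𝓝 U) := by
      simpa using (hlim (x ^ (1 / alpha m p))⁻¹).const_add U
    refine ge_of_tendsto' h fun k => ?_
    obtain ⟨l, hl, -⟩ := exists_cantorDensity_approx hm hp hf hf0 hx0 hx1 k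
    have h1 : (l : ℝ) / (cantorInt f l : ℝ) ^ (1 / alpha m p) ≤ U := by
      -- The index 0 is not among the ratios bounded by U, but U ≥ A > 0 covers its value 0.
      rcases Nat.eq_zero_or_pos l with rfl | h0
      · rw [Nat.cast_zero, zero_div]
        exact (hA.le.trans (hmem 1).1).trans (hU ⟨1, rfl⟩)
      · exact hU ⟨⟨l, h0⟩, rfl⟩
    rw [← hxB]
    linarith

/-- Every value of the density function on `(0,1]` recurs along a sequence tending to `0`. -/
theorem exists_seq_cantorDensity_eq (hm : 1 ≤ m) (hp : 0 < p) (hf : StrictMono f) (hf0 : f 0 = 0)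
    {y : ℝ} (hy : y ∈ cantorDensity f '' Ioc 0 1) :
    ∃ x : ℕ → ℝ, (∀ n, 0 < x n) ∧ Tendsto x atTop (𝓝 0) ∧ ∀ n, cantorDensity f (x n) = y := by
  obtain ⟨x, hx, rfl⟩ := hy
  have hp' : (1 : ℝ) ≤ p := by exact_mod_cast hp
  refine ⟨fun n => x / ((p : ℝ) + 1) ^ n, fun n => div_pos hx.1 (by positivity), ?_,
    fun n => cantorDensity_div_pow hm hp hf hf0 hx.1.le hx.2 n⟩
  exact tendsto_const_nhds.div_atTop (tendsto_pow_atTop_atTop_of_one_lt (by linarith))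

theorem limitPoints_cantorDensity (hm : 1 ≤ m) (hp : 0 < p) (hf : StrictMono f) (hf0 : f 0 = 0)
    {A B : ℝ} (himg : cantorDensity f '' Ioc 0 1 = Icc A B) :
    limitPoints (cantorDensity f) = Icc A B := by
  ext y
  constructor
  · rintro ⟨x, hx0, hx, hxy⟩
    refine isClosed_Icc.mem_of_tendsto hxy ?_
    filter_upwards [hx.eventually (gt_mem_nhds one_pos)] with n hn
    exact himg ▸ mem_image_of_mem _ ⟨hx0 n, hn.le⟩
  · intro hy
    obtain ⟨x, hx0, hx, hxy⟩ := exists_seq_cantorDensity_eq hm hp hf hf0 (himg ▸ hy)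
    refine ⟨x, hx0, hx, ?_⟩
    simp_rw [hxy]
    exact tendsto_const_nhds

theorem frequently_cantorDensity_eq (hm : 1 ≤ m) (hp : 0 < p) (hf : StrictMono f) (hf0 : f 0 = 0)
    {y : ℝ} (hy : y ∈ cantorDensity f '' Ioc 0 1) :
    ∃ᶠ x in 𝓝[>] 0, cantorDensity f x = y := by
  obtain ⟨x, hx0, hx, hxy⟩ := exists_seq_cantorDensity_eq hm hp hf hf0 hy
  have h : Tendsto x atTop (𝓝[>] 0) :=
    tendsto_nhdsWithin_iff.2 ⟨hx, Eventually.of_forall hx0⟩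
  exact h.frequently (Frequently.of_forall hxy)

theorem eventually_cantorDensity_mem {A B : ℝ} (himg : cantorDensity f '' Ioc 0 1 = Icc A B) :
    ∀ᶠ x in 𝓝[>] 0, cantorDensity f x ∈ Icc A B := by
  filter_upwards [Ioc_mem_nhdsGT one_pos] with x hx
  exact himg ▸ mem_image_of_mem _ hx

/-- A is eventually a lower bound and is attained arbitrarily close to 0. -/
theorem lowerDensity_cantorMeasure (hm : 1 ≤ m) (hp : 0 < p) (hf : StrictMono f) (hf0 : f 0 = 0)
    {A B : ℝ} (hAB : A ≤ B) (himg : cantorDensity f '' Ioc 0 1 = Icc A B) :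
    lowerDensity (cantorMeasure f) (1 / alpha m p) = A := by
  refine le_antisymm (liminf_le_of_frequently_le' ?_) (le_liminf_of_le (by isBoundedDefault) ?_)
  · exact (frequently_cantorDensity_eq hm hp hf hf0 (himg ▸ left_mem_Icc.2 hAB)).mono
      fun x hx => EReal.coe_le_coe_iff.2 hx.le
  · exact (eventually_cantorDensity_mem himg).mono fun x hx => EReal.coe_le_coe_iff.2 hx.1

theorem upperDensity_cantorMeasure (hm : 1 ≤ m) (hp : 0 < p) (hf : StrictMono f) (hf0 : f 0 = 0)
    {A B : ℝ} (hAB : A ≤ B) (himg : cantorDensity f '' Ioc 0 1 = Icc A B) :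
    upperDensity (cantorMeasure f) (1 / alpha m p) = B := by
  refine le_antisymm (limsup_le_of_le (by isBoundedDefault) ?_) (le_limsup_of_frequently_le' ?_)
  · exact (eventually_cantorDensity_mem himg).mono fun x hx => EReal.coe_le_coe_iff.2 hx.2
  · exact (frequently_cantorDensity_eq hm hp hf hf0 (himg ▸ right_mem_Icc.2 hAB)).mono
      fun x hx => EReal.coe_le_coe_iff.2 hx.ge

end Density

/-! ### Extrema under negative powers, and the main theorem -/

theorem rpow_ciSup_of_neg {ι : Type*} [Nonempty ι] {v : ι → ℝ} {t : ℝ} (hv : ∀ i, 0 < v i)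
    (hb : BddAbove (range v)) (ht : t < 0) : (⨆ i, v i) ^ t = ⨅ i, v i ^ t := by
  obtain ⟨i⟩ := ‹Nonempty ι›
  have hpos : 0 < sSup (range v) := (hv i).trans_le (le_csSup hb ⟨i, rfl⟩)
  have h := AntitoneOn.map_csSup_of_continuousWithinAt (f := fun x : ℝ => x ^ t)
    (Real.continuousAt_rpow_const _ t (Or.inl hpos.ne')).continuousWithinAt
    ((Real.antitoneOn_rpow_Ioi_of_exponent_nonpos ht.le).mono (range_subset_iff.2 hv))
    ⟨v i, i, rfl⟩ hb
  rwa [← range_comp] at h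

/-- The infimum must be positive: x ↦ x^t is decreasing on (0, ∞) but not continuous at 0. -/
theorem rpow_ciInf_of_neg {ι : Type*} [Nonempty ι] {v : ι → ℝ} {t : ℝ} (hv : ∀ i, 0 < v i)
    (h0 : 0 < ⨅ i, v i) (ht : t < 0) : (⨅ i, v i) ^ t = ⨆ i, v i ^ t := by
  obtain ⟨i⟩ := ‹Nonempty ι›
  have h := AntitoneOn.map_csInf_of_continuousWithinAt (f := fun x : ℝ => x ^ t) (A := range v)
    (Real.continuousAt_rpow_const _ t (Or.inl h0.ne')).continuousWithinAt
    ((Real.antitoneOn_rpow_Ioi_of_exponent_nonpos ht.le).mono (range_subset_iff.2 hv))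
    ⟨v i, i, rfl⟩ ⟨0, by rintro _ ⟨i, rfl⟩; exact (hv i).le⟩
  rwa [← range_comp] at h

end CantorIntegers

theorem corollary1 (m p : ℕ) (hm : 1 ≤ m) (hmp : m < p)
    (f : Fin (m + 1) → Fin (p + 1)) (hf : StrictMono f) (hf0 : f 0 = 0)
    (hfm : f (Fin.last m) = Fin.last p) :
    BddAbove (Set.range fun n : ℕ+ => (n : ℝ) /
        (CantorIntegers.cantorInt f n : ℝ) ^ (1 / CantorIntegers.alpha m p)) ∧
    CantorIntegers.limitPoints
        (CantorIntegers.density (CantorIntegers.cantorMeasure f)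
          (1 / CantorIntegers.alpha m p)) =
      Set.Icc
        (⨅ n : ℕ+, (n : ℝ) /
          (CantorIntegers.cantorInt f n : ℝ) ^ (1 / CantorIntegers.alpha m p))
        (⨆ n : ℕ+, (n : ℝ) /
          (CantorIntegers.cantorInt f n : ℝ) ^ (1 / CantorIntegers.alpha m p)) ∧
    BddAbove (Set.range fun n : ℕ+ =>
      (CantorIntegers.cantorInt f n : ℝ) / (n : ℝ) ^ CantorIntegers.alpha m p) ∧
    0 < (⨅ n : ℕ+,
      (CantorIntegers.cantorInt f n : ℝ) / (n : ℝ) ^ CantorIntegers.alpha m p) ∧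
    CantorIntegers.lowerDensity (CantorIntegers.cantorMeasure f)
        (1 / CantorIntegers.alpha m p) =
      (((⨆ n : ℕ+, (CantorIntegers.cantorInt f n : ℝ) /
          (n : ℝ) ^ CantorIntegers.alpha m p) ^ (-1 / CantorIntegers.alpha m p) : ℝ) : EReal) ∧
    CantorIntegers.upperDensity (CantorIntegers.cantorMeasure f)
        (1 / CantorIntegers.alpha m p) =
      (((⨅ n : ℕ+, (CantorIntegers.cantorInt f n : ℝ) /
          (n : ℝ) ^ CantorIntegers.alpha m p) ^ (-1 / CantorIntegers.alpha m p) : ℝ) : EReal) := by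
  have hp : 0 < p := by omega
  have hα := CantorIntegers.alpha_pos hm hp
  obtain ⟨A, B, hA, hAB, himg⟩ :=
    CantorIntegers.exists_image_cantorDensity_eq_Icc hm hp hf hf0
  obtain ⟨hglb, hlub⟩ :=
    CantorIntegers.isGLB_isLUB_cantorInt_ratio hm hp hf hf0 hA hAB himg
  have hC : ∀ n : ℕ+, (0 : ℝ) < CantorIntegers.cantorInt f n := fun n => by
    exact_mod_cast CantorIntegers.cantorInt_pos hm hf hf0 n.pos
  have hn : ∀ n : ℕ+, (0 : ℝ) < n := fun n => by exact_mod_cast n.pos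
  have hv : ∀ n : ℕ+, 0 < (CantorIntegers.cantorInt f n : ℝ) / (n : ℝ) ^ CantorIntegers.alpha m p :=
    fun n => div_pos (hC n) (Real.rpow_pos_of_pos (hn n) _)
  have huv : ∀ n : ℕ+, ((CantorIntegers.cantorInt f n : ℝ) /
      (n : ℝ) ^ CantorIntegers.alpha m p) ^ (-1 / CantorIntegers.alpha m p) =
      (n : ℝ) / (CantorIntegers.cantorInt f n : ℝ) ^ (1 / CantorIntegers.alpha m p) := by
    intro n
    rw [neg_div, Real.rpow_neg (hv n).le, Real.div_rpow (hC n).le (by positivity),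
      ← Real.rpow_mul (hn n).le, mul_one_div_cancel hα.ne', Real.rpow_one, inv_div]
  -- Inverting the previous relation transfers the bounds A and B on the ratios to C_n/n^α.
  have hvu : ∀ n : ℕ+, (CantorIntegers.cantorInt f n : ℝ) / (n : ℝ) ^ CantorIntegers.alpha m p =
      ((n : ℝ) / (CantorIntegers.cantorInt f n : ℝ) ^ (1 / CantorIntegers.alpha m p)) ^
        (-CantorIntegers.alpha m p) := by
    intro n
    rw [← huv, ← Real.rpow_mul (hv n).le,
      show -1 / CantorIntegers.alpha m p * -CantorIntegers.alpha m p = 1 by field_simp,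
      Real.rpow_one]
  have hu : ∀ n : ℕ+, A ≤ (n : ℝ) /
        (CantorIntegers.cantorInt f n : ℝ) ^ (1 / CantorIntegers.alpha m p) ∧ (n : ℝ) /
        (CantorIntegers.cantorInt f n : ℝ) ^ (1 / CantorIntegers.alpha m p) ≤ B := fun n =>
    ⟨hglb.1 ⟨n, rfl⟩, hlub.1 ⟨n, rfl⟩⟩
  have hbdd : BddAbove (Set.range fun n : ℕ+ =>
      (CantorIntegers.cantorInt f n : ℝ) / (n : ℝ) ^ CantorIntegers.alpha m p) := by
    refine ⟨A ^ (-CantorIntegers.alpha m p), ?_⟩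
    rintro _ ⟨n, rfl⟩
    change _ / _ ≤ _
    rw [hvu]
    exact Real.rpow_le_rpow_of_nonpos hA (hu n).1 (by linarith)
  have hinf : 0 < (⨅ n : ℕ+,
      (CantorIntegers.cantorInt f n : ℝ) / (n : ℝ) ^ CantorIntegers.alpha m p) := by
    refine (Real.rpow_pos_of_pos (hA.trans_le hAB) (-CantorIntegers.alpha m p)).trans_le
      (le_ciInf fun n => ?_)
    rw [hvu]
    exact Real.rpow_le_rpow_of_nonpos (hA.trans_le (hu n).1) (hu n).2 (by linarith)
  have ht : -1 / CantorIntegers.alpha m p < 0 := div_neg_of_neg_of_pos (by norm_num) hα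
  refine ⟨⟨B, hlub.1⟩, ?_, hbdd, hinf, ?_, ?_⟩
  · rw [hglb.ciInf_eq, hlub.ciSup_eq]
    exact CantorIntegers.limitPoints_cantorDensity hm hp hf hf0 himg
  · rw [CantorIntegers.rpow_ciSup_of_neg hv hbdd ht]
    simp_rw [huv]
    rw [hglb.ciInf_eq]
    exact CantorIntegers.lowerDensity_cantorMeasure hm hp hf hf0 hAB himg
  · rw [CantorIntegers.rpow_ciInf_of_neg hv hinf ht]
    simp_rw [huv]
    rw [hlub.ciSup_eq]
    exact CantorIntegers.upperDensity_cantorMeasure hm hp hf hf0 hAB himg
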